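/- An overpartition of $n$ is a partition of $n$ in which the first occurrence of each part size may or may not be overlined. For integers $m\ge 1$ and $n\ge 0$, let $A_m(n)$ be the number of overpartitions of $n$ in which only parts not divisible by $m$ may be overlined. Then for all integers $n\ge 0$, $$A_3(27n+26)\equiv 0 \pmod{12},\qquad A_9(27n+24)\equiv 0\pmod{24}.$$ -/

import Mathlib

/-- An overpartition of `n`: a partition of `n` in which the first occurrence of each part size may
or may not be overlined. It is recorded by the underlying partition together with the set of those
part sizes whose first occurrence is overlined. -/
@[ext]
structure Overpartition (n : ℕ) where
  /-- the underlying partition of `n` -/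
  partition : n.Partition
  /-- the part sizes whose first occurrence is overlined -/
  overlined : Finset ℕ
  overlined_subset : overlined ⊆ partition.parts.toFinset

/-- An overpartition is a partition with a member of the power set of its set of part sizes. -/
def Overpartition.equivSigma (n : ℕ) :
    Overpartition n ≃ (Σ p : n.Partition, {s : Finset ℕ // s ∈ p.parts.toFinset.powerset}) where
  toFun o := ⟨o.partition, o.overlined, Finset.mem_powerset.2 o.overlined_subset⟩
  invFun x := ⟨x.1, x.2.1, Finset.mem_powerset.1 x.2.2⟩
  left_inv _ := rfl
  right_inv _ := rfl

instance Overpartition.instFintype (n : ℕ) : Fintype (Overpartition n) :=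
  Fintype.ofEquiv _ (Overpartition.equivSigma n).symm

/-- `restrictedOverpartitionCount m n` is `A_m(n)`, the number of overpartitions of `n` in which
only parts not divisible by `m` may be overlined. -/
def restrictedOverpartitionCount (m n : ℕ) : ℕ :=
  Fintype.card {o : Overpartition n // ∀ k ∈ o.overlined, ¬ m ∣ k}

open PowerSeries PowerSeries.WithPiTopology Finset Filter

/-! Let `P = ∏ (1 + X^k)`, `E = ∏ (1 - X^k)`, and let `G` be the generating function of `A_m`. Then
`G · E · P(X^m) = P` (`overpartitionSeries_mul`).

Powers of two: by Gauss, `E / P = φ(-X) = 1 + 2S` with `S` supported on squares, so `G · P(X^m)` is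
`1 + 2S` modulo 4 and `1 - 2S + 4S²` modulo 8. Squares avoid the class 2 modulo 3; squares and sums
of two squares avoid 6 modulo 9. The unit `P(X^m)` does not mix exponent classes modulo `m`, so `G`
inherits the vanishing.

Modulo 3: `F(X³) = F³`, so with `ψ = P² E` the relation reads `ψ³ G = ψ²` for `m = 3` and `(ψ P²)³ G
= ψ²` for `m = 9`. The dissection `ψ = A(X³) + X ψ(X⁹)` (`theta_three_dissection`) gives the needed
sections of `ψ` and `ψ²`, and a factor `F³` leaves a section as `F`. Three sections, along the last
three base-3 digits of the exponent, end at the class 2 modulo 3 of `ψ`, which is empty.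

The products for `φ`, `ψ` and `A` are cases of the Jacobi triple product `hasSum_thetaTerm`,
obtained as the limit of a finite `q`-binomial identity. -/

/-- The Gaussian binomial coefficient `[n choose k]` at `Q`. -/
def gaussBinom {R : Type*} [CommRing R] (Q : R) : ℕ → ℕ → R
  | _, 0 => 1
  | 0, _ + 1 => 0
  | n + 1, k + 1 => gaussBinom Q n k + Q ^ (k + 1) * gaussBinom Q n (k + 1)

/-! ### Gaussian binomial coefficients. -/

section GaussBinom

variable {R : Type*} [CommRing R] (Q : R)

@[simp] lemma gaussBinom_zero_right (n : ℕ) : gaussBinom Q n 0 = 1 := by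
  cases n <;> rfl

lemma gaussBinom_succ_succ (n k : ℕ) :
    gaussBinom Q (n + 1) (k + 1) = gaussBinom Q n k + Q ^ (k + 1) * gaussBinom Q n (k + 1) := rfl

lemma gaussBinom_eq_zero_of_lt {n k : ℕ} (h : n < k) : gaussBinom Q n k = 0 := by
  induction n generalizing k with
  | zero => obtain ⟨k, rfl⟩ := Nat.exists_eq_succ_of_ne_zero h.ne'; rfl
  | succ n ih =>
    obtain ⟨k, rfl⟩ := Nat.exists_eq_succ_of_ne_zero (Nat.ne_zero_of_lt h)
    rw [Nat.succ_eq_add_one, gaussBinom_succ_succ, ih (by lia), ih (by lia)]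
    simp

lemma gaussBinom_self (n : ℕ) : gaussBinom Q n n = 1 := by
  induction n with
  | zero => rfl
  | succ n ih => rw [gaussBinom_succ_succ, ih, gaussBinom_eq_zero_of_lt Q (Nat.lt_succ_self n)]; simp

/-- The second Pascal rule for Gaussian binomial coefficients. -/
lemma gaussBinom_succ_succ' {n k : ℕ} (h : k ≤ n) :
    gaussBinom Q (n + 1) (k + 1) = Q ^ (n - k) * gaussBinom Q n k + gaussBinom Q n (k + 1) := by
  induction n generalizing k with
  | zero => obtain rfl : k = 0 := by lia
            simp [gaussBinom]
  | succ n ih =>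
    rcases h.eq_or_lt with rfl | hk
    · rw [gaussBinom_self, gaussBinom_self, gaussBinom_eq_zero_of_lt Q (Nat.lt_succ_self _)]; simp
    have hk : k ≤ n := by lia
    obtain ⟨c, rfl⟩ := Nat.exists_eq_add_of_le hk
    have e1 := ih hk
    have e2 := gaussBinom_succ_succ Q (k + c) k
    rw [gaussBinom_succ_succ]
    rw [show k + c - k = c by lia] at e1
    rw [show k + c + 1 - k = c + 1 by lia]
    cases k with
    | zero =>
      simp only [gaussBinom_zero_right] at *
      linear_combination Q * e1 - e2
    | succ k =>
      have e3 := ih (k := k) (by lia)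
      have e4 := gaussBinom_succ_succ Q (k + 1 + c) k
      rw [show k + 1 + c - k = c + 1 by lia] at e3
      linear_combination e3 + Q ^ (k + 2) * e1 - Q ^ (c + 1) * e4 - e2

lemma prod_mul_gaussBinom (i j : ℕ) :
    (∏ k ∈ range i, (1 - Q ^ (k + 1))) * (∏ k ∈ range j, (1 - Q ^ (k + 1))) *
      gaussBinom Q (i + j) i = ∏ k ∈ range (i + j), (1 - Q ^ (k + 1)) := by
  induction h : i + j generalizing i j with
  | zero =>
    obtain rfl : i = 0 := by lia
    obtain rfl : j = 0 := by lia
    simp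
  | succ n ih =>
    rcases i with _ | i
    · obtain rfl : j = n + 1 := by lia
      simp
    rcases j with _ | j
    · obtain rfl : i = n := by lia
      simp [gaussBinom_self]
    have h1 := ih i (j + 1) (by lia)
    have h2 := ih (i + 1) j (by lia)
    rw [gaussBinom_succ_succ, prod_range_succ _ n, prod_range_succ _ i, prod_range_succ _ j]
    rw [prod_range_succ _ j] at h1
    rw [prod_range_succ _ i] at h2
    obtain rfl : n = i + j + 1 := by lia
    linear_combination (1 - Q ^ (i + 1)) * h1 + Q ^ (i + 1) * (1 - Q ^ (j + 1)) * h2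

end GaussBinom

/-! ### Theta terms and the finite triple product. -/

/-- The `j`-th triangular number `j (j + 1) / 2`, for an integer `j`. -/
def triangularNat (j : ℤ) : ℕ := (j * (j + 1) / 2).toNat

lemma two_mul_triangularNat (j : ℤ) : 2 * (triangularNat j : ℤ) = j * (j + 1) := by
  have h2 : (2 : ℤ) ∣ j * (j + 1) := (Int.even_mul_succ_self j).two_dvd
  have h0 : 0 ≤ j * (j + 1) := by
    rcases lt_or_ge j 0 with h | h
    · nlinarith
    · positivity
  rw [triangularNat, Int.toNat_of_nonneg (by positivity)]
  exact Int.mul_ediv_cancel' h2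

section Theta

variable {R : Type*} [CommRing R] (a b : R)

/-- The general term `a ^ (j (j + 1) / 2) * b ^ (j (j - 1) / 2)` of Ramanujan's theta function. -/
def thetaTerm (j : ℤ) : R := a ^ triangularNat j * b ^ triangularNat (j - 1)

/-- Formally consecutive terms have ratio `a (ab)^j`; the extra factor `(ab)^r` keeps all exponents
natural when `j < 0`. -/
lemma thetaTerm_mul_left {j : ℤ} {m r : ℕ} (h : (m : ℤ) = j + r) :
    thetaTerm a b j * (a * (a * b) ^ m) = thetaTerm a b (j + 1) * (a * b) ^ r := by
  have h1 := two_mul_triangularNat j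
  have h2 := two_mul_triangularNat (j - 1)
  have h3 := two_mul_triangularNat (j + 1)
  have e1 : triangularNat j + 1 + m = triangularNat (j + 1) + r := by zify; linarith
  have e2 : triangularNat (j - 1) + m = triangularNat j + r := by zify; linarith
  simp only [thetaTerm, add_sub_cancel_right]
  calc _ = a ^ (triangularNat j + 1 + m) * b ^ (triangularNat (j - 1) + m) := by ring
    _ = _ := by rw [e1, e2]; ring

lemma thetaTerm_mul_right {j : ℤ} {n r : ℕ} (h : (n : ℤ) + j = r) :
    thetaTerm a b j * (b * (a * b) ^ n) = thetaTerm a b (j - 1) * (a * b) ^ r := by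
  have h1 := two_mul_triangularNat j
  have h2 := two_mul_triangularNat (j - 1)
  have h3 := two_mul_triangularNat (j - 1 - 1)
  have e1 : triangularNat j + n = triangularNat (j - 1) + r := by zify; linarith
  have e2 : triangularNat (j - 1) + 1 + n = triangularNat (j - 1 - 1) + r := by zify; linarith
  simp only [thetaTerm]
  calc _ = a ^ (triangularNat j + n) * b ^ (triangularNat (j - 1) + 1 + n) := by ring
    _ = _ := by rw [e1, e2]; ring

/-- The finite form of the Jacobi triple product identity. -/
theorem prod_one_add_mul_prod_one_add (m n : ℕ) :
    (∏ k ∈ range m, (1 + a * (a * b) ^ k)) * (∏ k ∈ range n, (1 + b * (a * b) ^ k)) =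
      ∑ i ∈ range (m + n + 1), gaussBinom (a * b) (m + n) i * thetaTerm a b (i - n) := by
  -- A new factor in `b` is absorbed by the first Pascal rule, a new factor in `a` by the second.
  induction m with
  | zero =>
    induction n with
    | zero => simp [thetaTerm, triangularNat]
    | succ n ih =>
      simp only [zero_add] at ih ⊢
      rw [prod_range_succ _ n, ← mul_assoc, ih, sum_range_succ' _ (n + 1), sum_mul]
      have : ∀ i ∈ range (n + 1), gaussBinom (a * b) (n + 1) (i + 1) *
          thetaTerm a b ((i + 1 : ℕ) - (n + 1 : ℕ)) =
          gaussBinom (a * b) n i * thetaTerm a b (i - n) +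
          gaussBinom (a * b) n (i + 1) * thetaTerm a b ((i + 1 : ℕ) - n) * (b * (a * b) ^ n) := by
        intro i _
        rw [mul_assoc (gaussBinom (a * b) n (i + 1)),
          thetaTerm_mul_right a b (r := i + 1) (by push_cast; ring), gaussBinom_succ_succ]
        rw [show ((i + 1 : ℕ) : ℤ) - (n + 1 : ℕ) = i - n by push_cast; ring,
          show ((i + 1 : ℕ) : ℤ) - n - 1 = i - n by push_cast; ring]
        ring
      rw [sum_congr rfl this, sum_add_distrib, add_assoc, ← sum_mul]
      rw [mul_add, mul_one]
      congr 1
      rw [sum_range_succ' _ n, sum_range_succ _ n, gaussBinom_eq_zero_of_lt _ (Nat.lt_succ_self n),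
        add_mul]
      simp only [gaussBinom_zero_right, one_mul, zero_mul, add_zero]
      congr 1
      · rw [sum_mul]
      rw [thetaTerm_mul_right a b (r := 0) (by push_cast; ring)]
      simp only [pow_zero, mul_one]
      congr 1
      push_cast
      ring
  | succ m ih =>
    rw [prod_range_succ _ m, mul_right_comm, ih, show m + 1 + n + 1 = m + n + 1 + 1 by ring,
      show m + 1 + n = m + n + 1 by ring, sum_range_succ' _ (m + n + 1)]
    have : ∀ i ∈ range (m + n + 1), gaussBinom (a * b) (m + n + 1) (i + 1) *
        thetaTerm a b ((i + 1 : ℕ) - n) =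
        gaussBinom (a * b) (m + n) i * thetaTerm a b (i - n) * (a * (a * b) ^ m) +
        gaussBinom (a * b) (m + n) (i + 1) * thetaTerm a b ((i + 1 : ℕ) - n) := by
      intro i hi
      have hi : i ≤ m + n := by simpa [Nat.lt_succ_iff] using hi
      rw [mul_assoc (gaussBinom (a * b) (m + n) i),
        thetaTerm_mul_left a b (r := m + n - i) (by push_cast [hi]; ring),
        gaussBinom_succ_succ' _ hi, show ((i + 1 : ℕ) : ℤ) - n = i - n + 1 by push_cast; ring]
      ring
    rw [sum_congr rfl this, sum_add_distrib, ← sum_mul]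
    suffices h : ∑ i ∈ range (m + n + 1), gaussBinom (a * b) (m + n) i * thetaTerm a b (i - n) =
        ∑ i ∈ range (m + n + 1), gaussBinom (a * b) (m + n) (i + 1) *
          thetaTerm a b ((i + 1 : ℕ) - n) + thetaTerm a b ((0 : ℕ) - n) by
      rw [gaussBinom_zero_right]
      linear_combination h
    rw [sum_range_succ' _ (m + n), sum_range_succ _ (m + n),
      gaussBinom_eq_zero_of_lt _ (Nat.lt_succ_self _)]
    simp

end Theta

/-! ### Passage to the infinite triple product. -/

section Limit

variable {R : Type*} [CommRing R]

lemma X_pow_dvd_prod_sub_prod {Q : R⟦X⟧} (hQ : X ∣ Q) {d m n : ℕ} (hm : d ≤ m) (hn : d ≤ n) :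
    X ^ (d + 1) ∣ ∏ k ∈ range m, (1 - Q ^ (k + 1)) - ∏ k ∈ range n, (1 - Q ^ (k + 1)) := by
  have key : ∀ e, X ^ (d + 1) ∣
      ∏ k ∈ range (d + e), (1 - Q ^ (k + 1)) - ∏ k ∈ range d, (1 - Q ^ (k + 1)) := by
    intro e
    induction e with
    | zero => simp
    | succ e ih =>
      rw [← add_assoc, prod_range_succ, mul_sub, mul_one, sub_right_comm]
      refine dvd_sub ih (Dvd.dvd.mul_left ?_ _)
      exact (pow_dvd_pow X (by lia)).trans (pow_dvd_pow_of_dvd hQ _)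
  obtain ⟨e, rfl⟩ := Nat.exists_eq_add_of_le hm
  obtain ⟨e', rfl⟩ := Nat.exists_eq_add_of_le hn
  simpa using dvd_sub (key e) (key e')

lemma isUnit_of_constantCoeff_eq_one {F : R⟦X⟧} (h : constantCoeff F = 1) : IsUnit F :=
  isUnit_iff_constantCoeff.2 (h ▸ isUnit_one)

/-- All products `∏ (1 - Q^(k+1))` with at least `d` factors agree modulo `X^(d+1)`, so
`prod_mul_gaussBinom` becomes `u² · [i+j choose i] ≡ u` with `u` a unit. -/
lemma X_pow_dvd_prod_mul_gaussBinom_sub_one {Q : R⟦X⟧} (hQ : X ∣ Q) {d n i j : ℕ}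
    (hi : d ≤ i) (hj : d ≤ j) (hn : d ≤ n) :
    X ^ (d + 1) ∣ (∏ k ∈ range n, (1 - Q ^ (k + 1))) * gaussBinom Q (i + j) i - 1 := by
  set u : ℕ → R⟦X⟧ := fun n ↦ ∏ k ∈ range n, (1 - Q ^ (k + 1)) with hu
  have hunit : ∀ n, IsUnit (u n) := fun n ↦ isUnit_of_constantCoeff_eq_one <| by
    simp [hu, map_prod, X_dvd_iff.1 hQ]
  have h := prod_mul_gaussBinom Q i j
  obtain ⟨x, hx⟩ := X_pow_dvd_prod_sub_prod hQ hi hn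
  obtain ⟨y, hy⟩ := X_pow_dvd_prod_sub_prod hQ hj hn
  obtain ⟨z, hz⟩ := X_pow_dvd_prod_sub_prod hQ (show d ≤ i + j by lia) hn
  refine (hunit n).dvd_mul_left.1 ⟨z - x * u j * gaussBinom Q (i + j) i -
    y * u n * gaussBinom Q (i + j) i, ?_⟩
  simp only [hu] at *
  linear_combination h + hz - hx * (∏ k ∈ range j, (1 - Q ^ (k + 1))) * gaussBinom Q (i + j) i -
    hy * (∏ k ∈ range n, (1 - Q ^ (k + 1))) * gaussBinom Q (i + j) i

lemma coeff_eq_of_X_pow_dvd_sub {d : ℕ} {F G : R⟦X⟧} (h : X ^ (d + 1) ∣ F - G) :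
    coeff d F = coeff d G := by
  have := X_pow_dvd_iff.1 h d (by lia)
  rwa [map_sub, sub_eq_zero] at this

lemma X_pow_dvd_thetaTerm {a b : R⟦X⟧} (ha : X ∣ a) (hb : X ∣ b) {d : ℕ} {j : ℤ}
    (hj : j ∉ Icc (-d : ℤ) d) : X ^ (d + 1) ∣ thetaTerm a b j := by
  rw [mem_Icc, not_and_or, not_le, not_le] at hj
  have h1 := two_mul_triangularNat j
  have h2 := two_mul_triangularNat (j - 1)
  rcases hj with hj | hj
  · refine Dvd.dvd.mul_left ((pow_dvd_pow X ?_).trans (pow_dvd_pow_of_dvd hb _)) _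
    zify; nlinarith
  · refine Dvd.dvd.mul_right ((pow_dvd_pow X ?_).trans (pow_dvd_pow_of_dvd ha _)) _
    zify; nlinarith

variable [TopologicalSpace R] [DiscreteTopology R]

/-- The **Jacobi triple product identity** for power series, in Ramanujan's form. -/
theorem hasSum_thetaTerm {a b : R⟦X⟧} (ha : X ∣ a) (hb : X ∣ b) {A B E : R⟦X⟧}
    (hA : HasProd (fun k ↦ 1 + a * (a * b) ^ k) A) (hB : HasProd (fun k ↦ 1 + b * (a * b) ^ k) B)
    (hE : HasProd (fun k ↦ 1 - (a * b) ^ (k + 1)) E) :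
    HasSum (thetaTerm a b) (A * B * E) := by
  rw [hasSum_iff_hasSum_coeff]
  intro d
  have hlim := (tendsto_iff_coeff_tendsto R _ _ _).1
    ((hA.tendsto_prod_nat.mul hB.tendsto_prod_nat).mul hE.tendsto_prod_nat) d
  have hev : ∀ᶠ n : ℕ in atTop, coeff d ((∏ k ∈ range n, (1 + a * (a * b) ^ k)) *
      (∏ k ∈ range n, (1 + b * (a * b) ^ k)) * ∏ k ∈ range n, (1 - (a * b) ^ (k + 1))) =
      ∑ j ∈ Icc (-d : ℤ) d, coeff d (thetaTerm a b j) := by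
    -- The index `i` of the finite identity stands for `j = i - n`. For `|j| ≤ d` and `n ≥ 2d`, both
    -- `i` and `2n - i` are at least `d`, so the Gaussian binomial times the third product is 1 up
    -- to degree `d`.
    filter_upwards [eventually_ge_atTop (2 * d)] with n hn
    rw [prod_one_add_mul_prod_one_add, sum_mul, map_sum]
    symm
    refine sum_bij_ne_zero (fun j _ _ ↦ (j + n).toNat) ?_ ?_ ?_ ?_
    · intro j hj _
      rw [mem_Icc] at hj
      rw [mem_range]; lia
    · intro j hj _ j' hj' _ h
      rw [mem_Icc] at hj hj'
      lia
    · intro i hi h0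
      have hij : (i : ℤ) - n ∈ Icc (-d : ℤ) d := by
        by_contra hcon
        refine h0 (X_pow_dvd_iff.1 ?_ d (Nat.lt_succ_self d))
        exact ((X_pow_dvd_thetaTerm ha hb hcon).mul_left _).mul_right _
      refine ⟨i - n, hij, ?_, by simp⟩
      rw [mem_Icc] at hij
      convert h0 using 1
      refine (coeff_eq_of_X_pow_dvd_sub ?_).symm
      obtain ⟨w, hw⟩ := X_pow_dvd_prod_mul_gaussBinom_sub_one (ha.mul_right b) (d := d) (n := n)
        (i := i) (j := n + n - i) (by lia) (by lia) (by lia)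
      rw [show i + (n + n - i) = n + n by lia] at hw
      exact ⟨w * thetaTerm a b (i - n), by linear_combination hw * thetaTerm a b (i - n)⟩
    · intro j hj _
      rw [mem_Icc] at hj
      refine (coeff_eq_of_X_pow_dvd_sub ?_).symm
      obtain ⟨w, hw⟩ := X_pow_dvd_prod_mul_gaussBinom_sub_one (ha.mul_right b) (d := d) (n := n)
        (i := (j + n).toNat) (j := n + n - (j + n).toNat) (by lia) (by lia) (by lia)
      rw [show (j + n).toNat + (n + n - (j + n).toNat) = n + n by lia] at hw
      rw [show (((j + n).toNat : ℕ) : ℤ) - n = j by lia]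
      exact ⟨w * thetaTerm a b j, by linear_combination hw * thetaTerm a b j⟩
  rw [tendsto_nhds_unique hlim (tendsto_const_nhds.congr' (hev.mono fun _ h ↦ h.symm))]
  exact hasSum_sum_of_ne_finset_zero fun j hj ↦
    X_pow_dvd_iff.1 (X_pow_dvd_thetaTerm ha hb hj) d (Nat.lt_succ_self d)

end Limit

/-! ### The generating function of `A_m`. -/

/-- The generating function of `restrictedOverpartitionCount m`. -/
noncomputable def overpartitionSeries (R : Type*) [CommRing R] (m : ℕ) : R⟦X⟧ :=
  Nat.Partition.genFun fun i _ ↦ if m ∣ i then 1 else 2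

lemma restrictedOverpartitionCount_eq_sum (m n : ℕ) :
    restrictedOverpartitionCount m n =
      ∑ p : n.Partition, 2 ^ #{k ∈ p.parts.toFinset | ¬ m ∣ k} := by
  let e : {o : Overpartition n // ∀ k ∈ o.overlined, ¬ m ∣ k} ≃
      Σ p : n.Partition, {s // s ∈ ({k ∈ p.parts.toFinset | ¬ m ∣ k} : Finset ℕ).powerset} :=
    { toFun o := ⟨o.1.partition, o.1.overlined, mem_powerset.2 fun k hk ↦
        mem_filter.2 ⟨o.1.overlined_subset hk, o.2 k hk⟩⟩
      invFun x := ⟨⟨x.1, x.2.1, fun k hk ↦ (mem_filter.1 (mem_powerset.1 x.2.2 hk)).1⟩,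
        fun k hk ↦ (mem_filter.1 (mem_powerset.1 x.2.2 hk)).2⟩
      left_inv _ := rfl
      right_inv _ := rfl }
  rw [restrictedOverpartitionCount, Fintype.card_congr e, Fintype.card_sigma]
  simp only [Fintype.card_coe, card_powerset]

lemma coeff_overpartitionSeries (R : Type*) [CommRing R] (m n : ℕ) :
    coeff n (overpartitionSeries R m) = (restrictedOverpartitionCount m n : R) := by
  rw [overpartitionSeries, Nat.Partition.coeff_genFun, restrictedOverpartitionCount_eq_sum]
  push_cast
  refine sum_congr rfl fun p _ ↦ ?_
  rw [Finsupp.prod, Multiset.toFinsupp_support, prod_ite]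
  simp

/-! ### Infinite products and theta functions. -/

section Products

variable {R : Type*} [CommRing R] [TopologicalSpace R]

lemma multipliable_one_add_of_dvd {c : ℕ → R⟦X⟧} (h : ∀ k, X ^ k ∣ c k) :
    Multipliable fun k ↦ 1 + c k := by
  nontriviality R
  refine multipliable_one_add_of_tendsto_order_atTop_nhds_top _ ?_
  refine ENat.tendsto_nhds_top_iff_natCast_lt.mpr fun n ↦ ?_
  filter_upwards [eventually_gt_atTop n] with k hk
  exact (Nat.cast_lt.2 hk).trans_le (le_order _ _ fun i hi ↦
    X_pow_dvd_iff.1 (h k) i (by exact_mod_cast hi))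

/-- The product of the factors `1 + ε X ^ (s k + r)` for `k ≥ 0`. -/
noncomputable def progressionProd (ε : R⟦X⟧) (s r : ℕ) : R⟦X⟧ := ∏' k : ℕ, (1 + ε * X ^ (s * k + r))

lemma hasProd_progressionProd (ε : R⟦X⟧) {s : ℕ} (r : ℕ) (hs : 0 < s) :
    HasProd (fun k : ℕ ↦ 1 + ε * X ^ (s * k + r)) (progressionProd ε s r) :=
  (multipliable_one_add_of_dvd fun k ↦ Dvd.dvd.mul_left (pow_dvd_pow X (by nlinarith)) _).hasProd

lemma hasProd_ite_dvd {m : ℕ} (hm : 0 < m) :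
    HasProd (fun i ↦ if m ∣ i + 1 then 1 + X ^ (i + 1) else (1 : R⟦X⟧))
      (progressionProd 1 m m) := by
  -- Index `i` stands for the part `i + 1`, so the multiples of `m` sit at `i = m k + m - 1`.
  have hinj : Function.Injective fun k ↦ m * k + m - 1 := fun k l h ↦ by
    have : m * k = m * l := by dsimp only at h; lia
    exact Nat.eq_of_mul_eq_mul_left hm this
  refine (hinj.hasProd_iff fun i hi ↦ if_neg fun hdvd ↦ hi ?_).1 ?_
  · obtain ⟨k, hk⟩ := hdvd
    obtain ⟨k, rfl⟩ : ∃ l, k = l + 1 := Nat.exists_eq_succ_of_ne_zero (by rintro rfl; lia)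
    exact ⟨k, by dsimp only; rw [mul_add, mul_one] at hk; lia⟩
  · refine (hasProd_progressionProd (1 : R⟦X⟧) m hm).congr_fun fun k ↦ ?_
    have : m * k + m - 1 + 1 = m * k + m := by lia
    simp only [Function.comp_apply, this, one_mul]
    exact if_pos ⟨k + 1, by ring⟩

variable [DiscreteTopology R]

lemma constantCoeff_progressionProd (ε : R⟦X⟧) {s r : ℕ} (hs : 0 < s) (hr : 0 < r) :
    constantCoeff (progressionProd ε s r) = 1 := by
  refine ((hasProd_progressionProd ε r hs).map (constantCoeff (R := R))
    (continuous_constantCoeff R)).unique ?_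
  convert hasProd_one with k
  simp [hr.ne']

lemma progressionProd_eq_mul_two (ε : R⟦X⟧) {s : ℕ} (r : ℕ) (hs : 0 < s) :
    progressionProd ε s r = progressionProd ε (2 * s) r * progressionProd ε (2 * s) (s + r) := by
  refine (hasProd_progressionProd ε r hs).unique (HasProd.even_mul_odd ?_ ?_)
  · convert hasProd_progressionProd ε r (show 0 < 2 * s by lia) using 5
    ring
  · convert hasProd_progressionProd ε (s + r) (show 0 < 2 * s by lia) using 5
    ring

lemma progressionProd_eq_mul_three (ε : R⟦X⟧) {s : ℕ} (r : ℕ) (hs : 0 < s) :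
    progressionProd ε s r = progressionProd ε (3 * s) r * progressionProd ε (3 * s) (s + r) *
      progressionProd ε (3 * s) (2 * s + r) := by
  have hs3 : 0 < 3 * s := by lia
  -- Both sides are compared along partial products of `3n` factors, regrouped in threes.
  have h := (hasProd_progressionProd ε r hs).tendsto_prod_nat.comp
    (tendsto_id.const_mul_atTop' (show 0 < 3 by simp))
  refine tendsto_nhds_unique h (Tendsto.congr (fun n ↦ ?_)
    (((hasProd_progressionProd ε r hs3).mul (hasProd_progressionProd ε (s + r) hs3)).mul
      (hasProd_progressionProd ε (2 * s + r) hs3)).tendsto_prod_nat)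
  induction n with
  | zero => simp
  | succ n ih =>
    rw [prod_range_succ, ih]
    simp only [Function.comp_apply, id_eq, mul_add, mul_one]
    rw [prod_range_succ, prod_range_succ, prod_range_succ]
    ring

lemma progressionProd_neg_mul (ε : R⟦X⟧) {s : ℕ} (r : ℕ) (hs : 0 < s) :
    progressionProd (-ε) s r * progressionProd ε s r =
      progressionProd (-ε ^ 2) (2 * s) (2 * r) := by
  refine ((hasProd_progressionProd (-ε) r hs).mul (hasProd_progressionProd ε r hs)).unique ?_
  convert hasProd_progressionProd (-ε ^ 2) (2 * r) (show 0 < 2 * s by lia) using 2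
  ring

lemma expand_progressionProd {m : ℕ} (hm : m ≠ 0) (ε : R⟦X⟧) (hε : expand m hm ε = ε) {s : ℕ}
    (r : ℕ) (hs : 0 < s) :
    expand m hm (progressionProd ε s r) = progressionProd ε (m * s) (m * r) := by
  have hcont : Continuous (expand (R := R) m hm) := by
    refine continuous_iff_continuousAt.2 fun F ↦ ?_
    rw [ContinuousAt, tendsto_iff_coeff_tendsto]
    intro d
    simp only [coeff_expand]
    split_ifs
    · exact (continuous_coeff R _).continuousAt
    · exact tendsto_const_nhds
  refine ((hasProd_progressionProd ε r hs).map (expand (R := R) m hm) hcont).unique ?_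
  convert hasProd_progressionProd ε (m * r) (Nat.mul_pos hm.bot_lt hs) using 2 with k
  simp [hε]
  ring

variable (R) in
/-- `∏ (1 - X ^ k)` over `k ≥ 1`. -/
noncomputable def eulerProd : R⟦X⟧ := progressionProd (-1) 1 1

variable (R) in
/-- `∏ (1 + X ^ k)` over `k ≥ 1`, the generating function of partitions into distinct parts. -/
noncomputable def distinctProd : R⟦X⟧ := progressionProd 1 1 1

lemma isUnit_eulerProd : IsUnit (eulerProd R) :=
  isUnit_of_constantCoeff_eq_one (constantCoeff_progressionProd _ one_pos one_pos)

lemma isUnit_distinctProd : IsUnit (distinctProd R) :=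
  isUnit_of_constantCoeff_eq_one (constantCoeff_progressionProd _ one_pos one_pos)

lemma expand_eulerProd {m : ℕ} (hm : m ≠ 0) :
    expand m hm (eulerProd R) = progressionProd (-1) m m := by
  rw [eulerProd, expand_progressionProd hm _ (by simp) _ one_pos, mul_one]

lemma expand_distinctProd {m : ℕ} (hm : m ≠ 0) :
    expand m hm (distinctProd R) = progressionProd 1 m m := by
  rw [distinctProd, expand_progressionProd hm _ (by simp) _ one_pos, mul_one]

theorem overpartitionSeries_mul {m : ℕ} (hm : m ≠ 0) :
    overpartitionSeries R m * eulerProd R * expand m hm (distinctProd R) = distinctProd R := by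
  rw [expand_distinctProd]
  have hG : HasProd _ (overpartitionSeries R m) :=
    Nat.Partition.hasProd_genFun fun i _ ↦ if m ∣ i then 1 else 2
  refine ((hG.mul (hasProd_progressionProd (-1) 1 one_pos)).mul
    (hasProd_ite_dvd hm.bot_lt)).unique ?_
  refine HasProd.congr_fun (hasProd_progressionProd 1 1 one_pos) fun i ↦ ?_
  -- With `x = X^(i+1)`, the Euler factor for a part size of weight `c` is `1 + c x / (1 - x)`.
  -- Clearing the denominator leaves `1 + x` for `c = 2` and 1 for `c = 1`; in the latter case
  -- `P(X^m)` supplies the missing `1 + x`.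
  have hgeom (c : R) : (1 + ∑' j, c • (X : R⟦X⟧) ^ ((i + 1) * (j + 1))) * (1 - X ^ (i + 1)) =
      1 + C (c - 1) * X ^ (i + 1) := by
    have h0 : constantCoeff ((X : R⟦X⟧) ^ (i + 1)) = 0 := by simp
    have h := tsum_pow_mul_one_sub_of_constantCoeff_eq_zero (R := R) h0
    have hs := summable_pow_of_constantCoeff_eq_zero (R := R) h0
    have : ∑' j, c • (X : R⟦X⟧) ^ ((i + 1) * (j + 1)) =
        (C c * X ^ (i + 1)) * ∑' j, ((X : R⟦X⟧) ^ (i + 1)) ^ j := by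
      rw [← hs.tsum_mul_left]
      refine tsum_congr fun j ↦ ?_
      rw [smul_eq_C_mul]
      ring
    rw [this, map_sub, map_one]
    linear_combination (C c * X ^ (i + 1)) * h
  rw [neg_one_mul, ← sub_eq_add_neg, one_mul i, one_mul, hgeom]
  split_ifs
  · simp
  · simp only [mul_one]
    norm_num

lemma eulerProd_mul_distinctProd :
    eulerProd R * distinctProd R = progressionProd (-1) 2 2 := by
  simpa [eulerProd, distinctProd] using progressionProd_neg_mul (1 : R⟦X⟧) 1 one_pos

/-- Euler's theorem that partitions into odd parts and into distinct parts are equinumerous. -/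
lemma progressionProd_odd_mul_distinctProd :
    progressionProd (-1) 2 1 * distinctProd R = 1 := by
  have h1 : eulerProd R = progressionProd (-1) 2 1 * progressionProd (-1) 2 2 :=
    progressionProd_eq_mul_two (-1) 1 one_pos
  have h2 := eulerProd_mul_distinctProd (R := R)
  refine isUnit_eulerProd.mul_left_cancel ?_
  linear_combination progressionProd (-1) 2 1 * h2 - h1

/-- Gauss' product for `φ(-X) = ∑ (-1) ^ j X ^ (j ^ 2)`. -/
theorem hasSum_thetaTerm_neg_X_neg_X :
    ∃ φ : R⟦X⟧, HasSum (thetaTerm (-X) (-X)) φ ∧ φ * distinctProd R = eulerProd R := by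
  refine ⟨_, hasSum_thetaTerm (A := progressionProd (-1) 2 1) (B := progressionProd (-1) 2 1)
    (E := progressionProd (-1) 2 2) (by simp) (by simp) ?_ ?_ ?_, ?_⟩
  · convert hasProd_progressionProd (-1 : R⟦X⟧) 1 two_pos using 2
    ring
  · convert hasProd_progressionProd (-1 : R⟦X⟧) 1 two_pos using 2
    ring
  · convert hasProd_progressionProd (-1 : R⟦X⟧) 2 two_pos using 2
    ring
  · have h1 : eulerProd R = progressionProd (-1) 2 1 * progressionProd (-1) 2 2 :=
      progressionProd_eq_mul_two (-1) 1 one_pos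
    linear_combination progressionProd (-1) 2 1 * progressionProd (-1) 2 2 *
      progressionProd_odd_mul_distinctProd (R := R) - h1

/-- Gauss' product for `ψ(X) = ∑ X ^ (2 j ^ 2 - j)`. -/
theorem hasSum_thetaTerm_X_X_pow_three :
    HasSum (thetaTerm X (X ^ 3)) (distinctProd R ^ 2 * eulerProd R) := by
  have h := hasSum_thetaTerm (R := R) (a := X) (b := X ^ 3) (A := progressionProd 1 4 1)
    (B := progressionProd 1 4 3) (E := progressionProd (-1) 4 4) (by simp)
    (dvd_pow_self X (by simp)) ?_ ?_ ?_
  · convert h using 1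
    have h1 : progressionProd (1 : R⟦X⟧) 2 1 = progressionProd 1 4 1 * progressionProd 1 4 3 :=
      progressionProd_eq_mul_two 1 1 two_pos
    have h2 : distinctProd R = progressionProd 1 2 1 * progressionProd 1 2 2 :=
      progressionProd_eq_mul_two 1 1 one_pos
    have h3 : progressionProd (-1 : R⟦X⟧) 2 2 * progressionProd 1 2 2 =
        progressionProd (-1) 4 4 := by
      simpa using progressionProd_neg_mul (1 : R⟦X⟧) 2 two_pos
    rw [← h1, ← h3, ← eulerProd_mul_distinctProd]
    linear_combination eulerProd R * distinctProd R * h2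
  · convert hasProd_progressionProd (1 : R⟦X⟧) 1 four_pos using 2
    ring
  · convert hasProd_progressionProd (1 : R⟦X⟧) 3 four_pos using 2
    ring
  · convert hasProd_progressionProd (-1 : R⟦X⟧) 4 four_pos using 2
    ring

/-- A product for `∑ X ^ (j (3 j - 1) / 2)`, the generating function of the pentagonal numbers. -/
theorem hasSum_thetaTerm_X_X_pow_two :
    ∃ A : R⟦X⟧, HasSum (thetaTerm X (X ^ 2)) A ∧
      A * expand 3 three_ne_zero (distinctProd R) =
        distinctProd R * expand 3 three_ne_zero (eulerProd R) := by
  refine ⟨_, hasSum_thetaTerm (A := progressionProd 1 3 1) (B := progressionProd 1 3 2)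
    (E := progressionProd (-1) 3 3) (by simp) (dvd_pow_self X (by simp)) ?_ ?_ ?_, ?_⟩
  · convert hasProd_progressionProd (1 : R⟦X⟧) 1 three_pos using 2
    ring
  · convert hasProd_progressionProd (1 : R⟦X⟧) 2 three_pos using 2
    ring
  · convert hasProd_progressionProd (-1 : R⟦X⟧) 3 three_pos using 2
    ring
  · have h1 : distinctProd R = progressionProd 1 3 1 * progressionProd 1 3 2 *
        progressionProd 1 3 3 := progressionProd_eq_mul_three 1 1 one_pos
    rw [expand_distinctProd, expand_eulerProd]
    linear_combination -progressionProd (-1) 3 3 * h1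

end Products

/-! ### Coefficients of the theta series. -/

section ThetaCoeff

lemma three_dvd_of_isSquare {n : ℕ} (h : IsSquare n) : n % 3 ≠ 2 ∧ (3 ∣ n → 9 ∣ n) := by
  obtain ⟨r, rfl⟩ := h
  refine ⟨?_, fun h ↦ ?_⟩
  · have : r % 3 = 0 ∨ r % 3 = 1 ∨ r % 3 = 2 := by lia
    rcases this with h | h | h <;> simp [Nat.mul_mod, h]
  · have h3 : 3 ∣ r := by simpa using Nat.prime_three.dvd_mul.1 h
    exact Nat.mul_dvd_mul h3 h3

/-- Completing the square gives `8 (2j² - j) + 1 = (4j - 1)²`; the sign of `j` decides whether the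
positive root is 1 or 3 modulo 4. -/
lemma exists_two_mul_sq_sub_eq_iff (d : ℕ) :
    (∃ j : ℤ, 2 * j ^ 2 - j = d) ↔ IsSquare (8 * d + 1) := by
  constructor
  · rintro ⟨j, hj⟩
    refine ⟨(4 * j - 1).natAbs, ?_⟩
    zify
    rw [← sq, sq_abs, ← hj]
    ring
  · rintro ⟨r, hr⟩
    have h2 : r % 4 = 1 ∨ r % 4 = 3 := by
      have : r % 4 = 0 ∨ r % 4 = 1 ∨ r % 4 = 2 ∨ r % 4 = 3 := by lia
      have h4 := congrArg (· % 4) hr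
      rcases this with h | h | h | h <;> simp [Nat.mul_mod, h] at h4 ⊢ <;> lia
    obtain ⟨k, hk⟩ : ∃ k, r = 4 * k + r % 4 := ⟨r / 4, by lia⟩
    rcases h2 with h | h <;> rw [h] at hk <;> subst hk <;> zify at hr
    · exact ⟨-k, by linarith⟩
    · exact ⟨k + 1, by linarith⟩

lemma exists_three_mul_sq_sub_eq_iff (d : ℕ) :
    (∃ j : ℤ, 3 * j ^ 2 - j = 2 * d) ↔ IsSquare (24 * d + 1) := by
  constructor
  · rintro ⟨j, hj⟩
    refine ⟨(6 * j - 1).natAbs, ?_⟩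
    zify
    rw [← sq, sq_abs]
    linarith
  · rintro ⟨r, hr⟩
    have h2 : r % 6 = 1 ∨ r % 6 = 5 := by
      have : r % 6 = 0 ∨ r % 6 = 1 ∨ r % 6 = 2 ∨ r % 6 = 3 ∨ r % 6 = 4 ∨ r % 6 = 5 := by lia
      have h6 := congrArg (· % 6) hr
      rcases this with h | h | h | h | h | h <;> simp [Nat.mul_mod, h] at h6 ⊢ <;> lia
    obtain ⟨k, hk⟩ : ∃ k, r = 6 * k + r % 6 := ⟨r / 6, by lia⟩
    rcases h2 with h | h <;> rw [h] at hk <;> subst hk <;> zify at hr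
    · exact ⟨-k, by linarith⟩
    · exact ⟨k + 1, by linarith⟩

variable {R : Type*} [CommRing R] [TopologicalSpace R] [DiscreteTopology R]

lemma coeff_of_hasSum_X_pow {e : ℤ → ℕ} (he : Function.Injective e) {F : R⟦X⟧}
    (h : HasSum (fun j ↦ X ^ e j) F) (d : ℕ) [Decidable (∃ j, e j = d)] :
    coeff d F = if ∃ j, e j = d then 1 else 0 := by
  have hd := (hasSum_iff_hasSum_coeff R).1 h d
  simp only [coeff_X_pow] at hd
  refine hd.unique ?_
  split_ifs with hex
  · obtain ⟨j, hj⟩ := hex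
    convert hasSum_single (f := fun i ↦ if d = e i then (1 : R) else 0) j fun i hi ↦ if_neg ?_
    · simp [hj]
    · rw [← hj]
      exact fun h ↦ hi (he h).symm
  · convert hasSum_zero with i
    exact if_neg fun h ↦ hex ⟨i, h.symm⟩

lemma coeff_of_hasSum_thetaTerm_X_X_pow_three {F : R⟦X⟧} (h : HasSum (thetaTerm X (X ^ 3)) F)
    (d : ℕ) : coeff d F = if IsSquare (8 * d + 1) then 1 else 0 := by
  classical
  have hcast (j : ℤ) : ((triangularNat j + 3 * triangularNat (j - 1) : ℕ) : ℤ) = 2 * j ^ 2 - j := by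
    have h1 := two_mul_triangularNat j
    have h2 := two_mul_triangularNat (j - 1)
    push_cast
    linarith
  rw [coeff_of_hasSum_X_pow (e := fun j ↦ triangularNat j + 3 * triangularNat (j - 1)) ?_
    (h.congr_fun fun j ↦ by rw [thetaTerm]; ring) d]
  · refine if_congr ?_ rfl rfl
    rw [← exists_two_mul_sq_sub_eq_iff]
    refine exists_congr fun j ↦ ?_
    rw [← hcast, Nat.cast_inj]
  · intro j k hjk
    have h : (2 * j ^ 2 - j : ℤ) = 2 * k ^ 2 - k := by
      rw [← hcast, ← hcast]
      exact congrArg _ hjk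
    have : (j - k) * (2 * (j + k) - 1) = 0 := by linarith
    rcases mul_eq_zero.1 this with h | h <;> lia

lemma coeff_of_hasSum_thetaTerm_X_X_pow_two {F : R⟦X⟧} (h : HasSum (thetaTerm X (X ^ 2)) F)
    (d : ℕ) : coeff d F = if IsSquare (24 * d + 1) then 1 else 0 := by
  classical
  have hcast (j : ℤ) :
      2 * ((triangularNat j + 2 * triangularNat (j - 1) : ℕ) : ℤ) = 3 * j ^ 2 - j := by
    have h1 := two_mul_triangularNat j
    have h2 := two_mul_triangularNat (j - 1)
    push_cast
    linarith
  rw [coeff_of_hasSum_X_pow (e := fun j ↦ triangularNat j + 2 * triangularNat (j - 1)) ?_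
    (h.congr_fun fun j ↦ by rw [thetaTerm]; ring) d]
  · refine if_congr ?_ rfl rfl
    rw [← exists_three_mul_sq_sub_eq_iff]
    refine exists_congr fun j ↦ ?_
    rw [← hcast]
    lia
  · intro j k hjk
    have h : (3 * j ^ 2 - j : ℤ) = 3 * k ^ 2 - k := by
      rw [← hcast, ← hcast]
      exact congrArg (fun n : ℕ ↦ 2 * (n : ℤ)) hjk
    have : (j - k) * (3 * (j + k) - 1) = 0 := by linarith
    rcases mul_eq_zero.1 this with h | h <;> lia

/-- The terms `j` and `-j` coincide, and `j = 0` contributes the 1. -/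
lemma exists_eq_one_add_two_mul_of_hasSum_thetaTerm {φ : R⟦X⟧}
    (h : HasSum (thetaTerm (-X) (-X)) φ) :
    ∃ S : R⟦X⟧, φ = 1 + 2 * S ∧ ∀ n, ¬ IsSquare n → coeff n S = 0 := by
  refine ⟨.mk fun d ↦ if d = 0 then 0 else if IsSquare d then (-1) ^ d else 0, ?_,
    fun n hn ↦ by simp [hn]⟩
  have hexp (j : ℤ) : triangularNat j + triangularNat (j - 1) = j.natAbs ^ 2 := by
    have h1 := two_mul_triangularNat j
    have h2 := two_mul_triangularNat (j - 1)
    zify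
    rw [sq_abs]
    linarith
  have hterm (d : ℕ) (j : ℤ) : coeff d (thetaTerm (-X) (-X) j : R⟦X⟧) =
      if j.natAbs ^ 2 = d then (-1) ^ d else 0 := by
    rw [thetaTerm, ← pow_add, hexp, neg_pow, ← map_one C, ← map_neg, ← map_pow, coeff_C_mul_X_pow]
    split_ifs with h1 h2 h2 <;> simp_all
  ext d
  have hd := (hasSum_iff_hasSum_coeff R).1 h d
  simp only [hterm] at hd
  refine hd.unique ?_
  rw [two_mul, map_add, map_add, coeff_mk, coeff_one]
  rcases eq_or_ne d 0 with rfl | hd0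
  · convert hasSum_single (f := fun j : ℤ ↦ if j.natAbs ^ 2 = 0 then (-1 : R) ^ 0 else 0) 0 ?_
    · simp
    · intro j hj
      simp [hj]
  by_cases hsq : IsSquare d
  · obtain ⟨s, rfl⟩ := hsq
    have hs : s ≠ 0 := by rintro rfl; simp at hd0
    have hne : (s : ℤ) ≠ -s := by lia
    convert hasSum_sum_of_ne_finset_zero (s := ({(s : ℤ), -(s : ℤ)} : Finset ℤ))
      (L := SummationFilter.unconditional ℤ)
      (f := fun j : ℤ ↦ if j.natAbs ^ 2 = s * s then (-1 : R) ^ (s * s) else 0) ?_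
    · rw [sum_pair hne]
      simp [hs, sq]
    · intro j hj
      refine if_neg fun h ↦ hj ?_
      rw [← sq, Nat.pow_left_inj two_ne_zero] at h
      simp only [mem_insert, mem_singleton]
      lia
  · convert hasSum_zero with j
    · refine if_neg fun h ↦ hsq ⟨j.natAbs, by rw [← h, sq]⟩
    · simp [hd0, hsq]

end ThetaCoeff

/-! ### Sections along arithmetic progressions. -/

/-- The series of the coefficients of `F` at the exponents `m n + r`. -/
noncomputable def multisection {R : Type*} [CommRing R] (m r : ℕ) : R⟦X⟧ →ₗ[R] R⟦X⟧ where
  toFun F := .mk fun n ↦ coeff (m * n + r) F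
  map_add' F G := by ext; simp
  map_smul' c F := by ext; simp

section Multisection

variable {R : Type*} [CommRing R]

@[simp] lemma coeff_multisection (m r n : ℕ) (F : R⟦X⟧) :
    coeff n (multisection m r F) = coeff (m * n + r) F := by
  simp [multisection]

lemma multisection_expand_mul {m r : ℕ} (hm : m ≠ 0) (hr : r < m) (F G : R⟦X⟧) :
    multisection m r (expand m hm F * G) = F * multisection m r G := by
  ext n
  rw [coeff_multisection, coeff_mul, coeff_mul]
  symm
  refine sum_of_injOn (fun x ↦ (m * x.1, m * x.2 + r)) ?_ ?_ ?_ ?_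
  · rintro ⟨i, j⟩ _ ⟨k, l⟩ _ h
    simp only [Prod.mk.injEq, add_left_inj, mul_eq_mul_left_iff, hm, or_false] at h
    exact Prod.ext h.1 h.2
  · rintro ⟨i, j⟩ h
    simp only [mem_coe, HasAntidiagonal.mem_antidiagonal] at h ⊢
    rw [← h]
    ring
  · rintro ⟨i, j⟩ h hne
    rw [HasAntidiagonal.mem_antidiagonal] at h
    dsimp only at h ⊢
    rw [coeff_expand_of_not_dvd, zero_mul]
    rintro ⟨k, rfl⟩
    have hk : k ≤ n := by
      by_contra! hk
      have : m * (n + 1) ≤ m * k := Nat.mul_le_mul_left m hk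
      rw [mul_add] at this
      lia
    obtain ⟨l, rfl⟩ := Nat.exists_eq_add_of_le hk
    refine hne ⟨(k, l), by simp, ?_⟩
    rw [mul_add] at h
    exact Prod.ext rfl (by dsimp only; lia)
  · rintro ⟨i, j⟩ _
    simp

end Multisection

/-- Frobenius is the identity on the coefficients `ZMod p`. -/
lemma expand_eq_pow (p : ℕ) [Fact p.Prime] (F : (ZMod p)⟦X⟧) :
    expand p (NeZero.ne p) F = F ^ p := by
  have h := MvPowerSeries.map_frobenius_expand p (NeZero.ne p) (f := F)
  rw [ZMod.frobenius_zmod, MvPowerSeries.map_id] at h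
  exact h

/-! ### Divisibility by 4 and by 8. -/

section PowersOfTwo

variable {R : Type*} [CommRing R] [TopologicalSpace R] [DiscreteTopology R]

theorem exists_overpartitionSeries_mul_eq_one {m : ℕ} (hm : m ≠ 0) :
    ∃ S : R⟦X⟧, (∀ n, ¬ IsSquare n → coeff n S = 0) ∧
      overpartitionSeries R m * (1 + 2 * S) * expand m hm (distinctProd R) = 1 := by
  obtain ⟨φ, hφ, h⟩ := hasSum_thetaTerm_neg_X_neg_X (R := R)
  obtain ⟨S, rfl, hS⟩ := exists_eq_one_add_two_mul_of_hasSum_thetaTerm hφ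
  refine ⟨S, hS, isUnit_distinctProd.mul_right_cancel ?_⟩
  linear_combination overpartitionSeries_mul (R := R) hm +
    overpartitionSeries R m * expand m hm (distinctProd R) * h

lemma multisection_eq_zero_of_expand_mul {m r : ℕ} (hm : m ≠ 0) (hr : r < m) {F G : R⟦X⟧}
    (h : F * expand m hm (distinctProd R) = G) (hG : multisection m r G = 0) :
    multisection m r F = 0 := by
  rw [← h, mul_comm, multisection_expand_mul hm hr] at hG
  exact isUnit_distinctProd.mul_right_eq_zero.1 hG

end PowersOfTwo

theorem four_dvd_restrictedOverpartitionCount_three (n : ℕ) :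
    4 ∣ restrictedOverpartitionCount 3 (3 * n + 2) := by
  obtain ⟨S, hS, h⟩ := exists_overpartitionSeries_mul_eq_one (R := ZMod 4) three_ne_zero
  have h4 : (4 : (ZMod 4)⟦X⟧) = 0 := by
    rw [← map_ofNat C 4, show (OfNat.ofNat 4 : ZMod 4) = 0 from rfl, map_zero]
  -- Modulo 4, `1 + 2S` is its own inverse, as `(1 + 2S)² = 1 + 4(S + S²)`. Writing `S + S` lets
  -- coefficients be taken termwise.
  have hG : overpartitionSeries (ZMod 4) 3 * expand 3 three_ne_zero (distinctProd (ZMod 4)) =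
      1 + S + S := by
    linear_combination (1 + 2 * S) * h - overpartitionSeries (ZMod 4) 3 *
      expand 3 three_ne_zero (distinctProd (ZMod 4)) * (S + S ^ 2) * h4
  have hz := multisection_eq_zero_of_expand_mul three_ne_zero (r := 2) (by simp) hG ?_
  · rw [← ZMod.natCast_eq_zero_iff, ← coeff_overpartitionSeries, ← coeff_multisection, hz, map_zero]
  · ext k
    have hk : ¬ IsSquare (3 * k + 2) := fun h ↦ (three_dvd_of_isSquare h).1 (by lia)
    simp [coeff_one, hS _ hk]

lemma mod_nine_of_isSquare {n : ℕ} (h : IsSquare n) :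
    n % 9 = 0 ∨ n % 9 = 1 ∨ n % 9 = 4 ∨ n % 9 = 7 := by
  obtain ⟨r, rfl⟩ := h
  have h9 : r % 9 < 9 := Nat.mod_lt _ (by simp)
  rw [Nat.mul_mod]
  interval_cases r % 9 <;> simp

theorem eight_dvd_restrictedOverpartitionCount_nine (n : ℕ) :
    8 ∣ restrictedOverpartitionCount 9 (9 * n + 6) := by
  have h9 : (9 : ℕ) ≠ 0 := by simp
  obtain ⟨S, hS, h⟩ := exists_overpartitionSeries_mul_eq_one (R := ZMod 8) h9
  have h8 : (8 : (ZMod 8)⟦X⟧) = 0 := by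
    rw [← map_ofNat C 8, show (OfNat.ofNat 8 : ZMod 8) = 0 from rfl, map_zero]
  -- Inversion modulo 8 from `(1 + 2S)(1 - 2S + 4S²) = 1 + 8S³`.
  have hG : overpartitionSeries (ZMod 8) 9 * expand 9 h9 (distinctProd (ZMod 8)) =
      1 - (S + S) + (S * S + S * S + S * S + S * S) := by
    linear_combination (1 - 2 * S + 4 * S ^ 2) * h - overpartitionSeries (ZMod 8) 9 *
      expand 9 h9 (distinctProd (ZMod 8)) * S ^ 3 * h8
  have hz := multisection_eq_zero_of_expand_mul h9 (r := 6) (by simp) hG ?_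
  · rw [← ZMod.natCast_eq_zero_iff, ← coeff_overpartitionSeries, ← coeff_multisection, hz, map_zero]
  · ext k
    have hk : ¬ IsSquare (9 * k + 6) := fun h ↦ by
      have := mod_nine_of_isSquare h
      lia
    have hk2 : coeff (9 * k + 6) (S * S) = 0 := by
      rw [coeff_mul]
      refine sum_eq_zero fun x hx ↦ ?_
      rw [HasAntidiagonal.mem_antidiagonal] at hx
      by_cases h1 : IsSquare x.1
      · by_cases h2 : IsSquare x.2
        · have := mod_nine_of_isSquare h1
          have := mod_nine_of_isSquare h2
          lia
        · rw [hS _ h2, mul_zero]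
      · rw [hS _ h1, zero_mul]
    simp [coeff_one, hS _ hk, hk2]

/-! ### Divisibility by 3. -/

section ModThree

lemma expand_three_eq_pow (F : (ZMod 3)⟦X⟧) : expand 3 three_ne_zero F = F ^ 3 := expand_eq_pow 3 F

lemma multisection_three_pow_mul {r : ℕ} (hr : r < 3) (F G : (ZMod 3)⟦X⟧) :
    multisection 3 r (F ^ 3 * G) = F * multisection 3 r G := by
  rw [← expand_three_eq_pow, multisection_expand_mul _ hr]

lemma multisection_three_X_pow {r k : ℕ} (hk : k < 3) :
    multisection 3 r (X ^ k : (ZMod 3)⟦X⟧) = if r = k then 1 else 0 := by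
  ext n
  split_ifs with h
  · simp only [coeff_multisection, coeff_X_pow, coeff_one]
    exact if_congr (by lia) rfl rfl
  · simp only [coeff_multisection, coeff_X_pow, map_zero]
    exact if_neg (by lia)

/-- For `n = 3k`, `8n + 1 = 24k + 1`, which gives `A`. For `n ≡ 1` modulo 3, a square `8n + 1` is
divisible by 9, so `n = 9k + 1` and `8n + 1 = 9(8k + 1)`. For `n ≡ 2`, `8n + 1 ≡ 2` modulo 3 is no
square. The shape cube times `X^k` suits `multisection_three_pow_mul`. -/
lemma theta_three_dissection {ψ A : (ZMod 3)⟦X⟧}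
    (hψ : ∀ n, coeff n ψ = if IsSquare (8 * n + 1) then 1 else 0)
    (hA : ∀ n, coeff n A = if IsSquare (24 * n + 1) then 1 else 0) :
    ψ = A ^ 3 * X ^ 0 + (ψ ^ 3) ^ 3 * X ^ 1 := by
  rw [pow_zero, pow_one, mul_one, ← expand_three_eq_pow, ← expand_three_eq_pow,
    ← expand_three_eq_pow, ← expand_mul 3 three_ne_zero 3 three_ne_zero]
  ext n
  rw [map_add, coeff_expand, hψ]
  rcases n with _ | n
  · simp [hA]
  rw [coeff_succ_mul_X, coeff_expand, hψ, hA]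
  by_cases h3 : 3 ∣ n + 1
  · obtain ⟨k, hk⟩ := h3
    rw [if_pos (c := 3 ∣ n + 1) ⟨k, hk⟩, if_neg (c := 3 * 3 ∣ n) (by lia), add_zero, hk,
      Nat.mul_div_cancel_left _ three_pos, ← mul_assoc 8 3 k,
      show 8 * 3 = 24 by rfl]
  rw [if_neg h3, zero_add]
  by_cases h9 : 9 ∣ n
  · obtain ⟨k, rfl⟩ := h9
    rw [if_pos (c := 3 * 3 ∣ 9 * k) ⟨k, rfl⟩, Nat.mul_div_cancel_left _ (by simp)]
    refine if_congr ?_ rfl rfl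
    rw [show 8 * (9 * k + 1) + 1 = 3 ^ 2 * (8 * k + 1) by ring]
    constructor
    · rintro ⟨r, hr⟩
      obtain ⟨s, rfl⟩ : 3 ∣ r := (Nat.pow_dvd_pow_iff two_ne_zero).1 ⟨8 * k + 1, by rw [hr, sq]⟩
      exact ⟨s, by lia⟩
    · exact fun h ↦ (IsSquare.sq 3).mul h
  · rw [if_neg (c := 3 * 3 ∣ n) h9, if_neg]
    intro h
    have := three_dvd_of_isSquare h
    lia

theorem exists_psi_dissection :
    ∃ ψ A : (ZMod 3)⟦X⟧, ψ = A ^ 3 * X ^ 0 + (ψ ^ 3) ^ 3 * X ^ 1 ∧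
      ψ = distinctProd (ZMod 3) ^ 2 * eulerProd (ZMod 3) ∧
      A * distinctProd (ZMod 3) ^ 2 = eulerProd (ZMod 3) ^ 3 := by
  obtain ⟨A, hA, h⟩ := hasSum_thetaTerm_X_X_pow_two (R := ZMod 3)
  refine ⟨_, A, theta_three_dissection
    (coeff_of_hasSum_thetaTerm_X_X_pow_three hasSum_thetaTerm_X_X_pow_three)
    (coeff_of_hasSum_thetaTerm_X_X_pow_two hA), rfl, isUnit_distinctProd.mul_right_cancel ?_⟩
  rw [expand_three_eq_pow, expand_three_eq_pow] at h
  linear_combination h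

variable {ψ A : (ZMod 3)⟦X⟧}

lemma multisection_two_psi (h : ψ = A ^ 3 * X ^ 0 + (ψ ^ 3) ^ 3 * X ^ 1) :
    multisection 3 2 ψ = 0 := by
  rw [h, map_add, multisection_three_pow_mul (by simp), multisection_three_pow_mul (by simp),
    multisection_three_X_pow (by simp), multisection_three_X_pow (by simp)]
  simp

lemma psi_sq (h : ψ = A ^ 3 * X ^ 0 + (ψ ^ 3) ^ 3 * X ^ 1) :
    ψ ^ 2 = (A ^ 2) ^ 3 * X ^ 0 + (A * ψ ^ 3) ^ 3 * X ^ 1 + (A * ψ ^ 3) ^ 3 * X ^ 1 +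
      (ψ ^ 6) ^ 3 * X ^ 2 := by
  nth_rw 1 [h]
  ring

lemma multisection_zero_psi_sq (h : ψ = A ^ 3 * X ^ 0 + (ψ ^ 3) ^ 3 * X ^ 1) :
    multisection 3 0 (ψ ^ 2) = A ^ 2 := by
  rw [psi_sq h]
  simp only [map_add, multisection_three_pow_mul, multisection_three_X_pow, Nat.ofNat_pos,
    Nat.one_lt_ofNat, Nat.lt_succ_self]
  simp

lemma multisection_two_psi_sq (h : ψ = A ^ 3 * X ^ 0 + (ψ ^ 3) ^ 3 * X ^ 1) :
    multisection 3 2 (ψ ^ 2) = ψ ^ 6 := by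
  rw [psi_sq h]
  simp only [map_add, multisection_three_pow_mul, multisection_three_X_pow, Nat.ofNat_pos,
    Nat.one_lt_ofNat, Nat.lt_succ_self]
  simp

end ModThree

theorem three_dvd_restrictedOverpartitionCount_three (n : ℕ) :
    3 ∣ restrictedOverpartitionCount 3 (27 * n + 26) := by
  obtain ⟨ψ, A, h, hψ, -⟩ := exists_psi_dissection
  have hG := overpartitionSeries_mul (R := ZMod 3) three_ne_zero
  rw [expand_three_eq_pow] at hG
  set p := distinctProd (ZMod 3)
  set f := eulerProd (ZMod 3)
  set G := overpartitionSeries (ZMod 3) 3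
  have hp : IsUnit p := isUnit_distinctProd
  have hu : IsUnit ψ := hψ ▸ (hp.pow 2).mul isUnit_eulerProd
  have h1 : ψ ^ 3 * G = ψ ^ 2 := hp.mul_left_cancel <| by
    linear_combination ψ ^ 2 * hG + ψ ^ 2 * G * p * hψ
  have h2 := congrArg (multisection 3 2) h1
  rw [multisection_three_pow_mul (by simp), multisection_two_psi_sq h] at h2
  -- The section is `ψ⁵`, split so that the cube passes through the next section and leaves `ψ²`.
  replace h2 : multisection 3 2 G = ψ ^ 3 * ψ ^ 2 := hu.mul_left_cancel (h2.trans (by ring))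
  have h3 := congrArg (multisection 3 2) h2
  rw [multisection_three_pow_mul (by simp), multisection_two_psi_sq h,
    show ψ * ψ ^ 6 = (ψ ^ 2) ^ 3 * ψ by ring] at h3
  have h4 := congrArg (multisection 3 2) h3
  rw [multisection_three_pow_mul (by simp), multisection_two_psi h, mul_zero] at h4
  rw [← ZMod.natCast_eq_zero_iff, ← coeff_overpartitionSeries,
    show 27 * n + 26 = 3 * (3 * (3 * n + 2) + 2) + 2 by ring]
  simpa using congrArg (coeff n) h4

theorem three_dvd_restrictedOverpartitionCount_nine (n : ℕ) :
    3 ∣ restrictedOverpartitionCount 9 (27 * n + 24) := by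
  obtain ⟨ψ, A, h, hψ, hA⟩ := exists_psi_dissection
  have hG := overpartitionSeries_mul (R := ZMod 3) (Nat.mul_ne_zero three_ne_zero three_ne_zero)
  rw [expand_mul 3 three_ne_zero 3 three_ne_zero, expand_three_eq_pow, expand_three_eq_pow] at hG
  set p := distinctProd (ZMod 3)
  set f := eulerProd (ZMod 3)
  set G := overpartitionSeries (ZMod 3) (3 * 3)
  have hp : IsUnit p := isUnit_distinctProd
  have hf : IsUnit f := isUnit_eulerProd
  have hu : IsUnit ψ := hψ ▸ (hp.pow 2).mul hf
  have h1 : (ψ * p ^ 2) ^ 3 * G = ψ ^ 2 := hp.mul_left_cancel <| by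
    linear_combination ψ ^ 2 * hG + ψ ^ 2 * G * p ^ 7 * hψ
  have h2 := congrArg (multisection 3 0) h1
  rw [multisection_three_pow_mul (by simp), multisection_zero_psi_sq h] at h2
  -- Multiplying by `ψ² p⁴` makes the left factor a cube again, and `A p² = f³` turns `A² p⁴` into
  -- `(f²)³`.
  replace h2 : (ψ * p ^ 2) ^ 3 * multisection 3 0 G = (f ^ 2) ^ 3 * ψ ^ 2 := by
    linear_combination ψ ^ 2 * p ^ 4 * h2 + ψ ^ 2 * (A * p ^ 2 + f ^ 3) * hA
  have h3 := congrArg (multisection 3 2) h2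
  rw [multisection_three_pow_mul (by simp), multisection_three_pow_mul (by simp),
    multisection_two_psi_sq h] at h3
  -- Multiplying by `f` turns `ψ p²` into `ψ²`, which cancels.
  replace h3 : multisection 3 2 (multisection 3 0 G) = (f * ψ) ^ 3 * ψ :=
    (hu.pow 2).mul_left_cancel <| by
      linear_combination f * h3 + ψ * multisection 3 2 (multisection 3 0 G) * hψ
  have h4 := congrArg (multisection 3 2) h3
  rw [multisection_three_pow_mul (by simp), multisection_two_psi h, mul_zero] at h4
  rw [← ZMod.natCast_eq_zero_iff, ← coeff_overpartitionSeries,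
    show 27 * n + 24 = 3 * (3 * (3 * n + 2) + 2) + 0 by ring]
  simpa using congrArg (coeff n) h4

theorem mainTheorem4 :
    (∀ n : ℕ, restrictedOverpartitionCount 3 (27 * n + 26) ≡ 0 [MOD 12]) ∧
      (∀ n : ℕ, restrictedOverpartitionCount 9 (27 * n + 24) ≡ 0 [MOD 24]) := by
  refine ⟨fun n ↦ Nat.modEq_zero_iff_dvd.2 ?_, fun n ↦ Nat.modEq_zero_iff_dvd.2 ?_⟩
  · refine Nat.Coprime.mul_dvd_of_dvd_of_dvd (m := 3) (n := 4) (by norm_num)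
      (three_dvd_restrictedOverpartitionCount_three n) ?_
    simpa [show 27 * n + 26 = 3 * (9 * n + 8) + 2 by ring] using
      four_dvd_restrictedOverpartitionCount_three (9 * n + 8)
  · refine Nat.Coprime.mul_dvd_of_dvd_of_dvd (m := 3) (n := 8) (by norm_num)
      (three_dvd_restrictedOverpartitionCount_nine n) ?_
    simpa [show 27 * n + 24 = 9 * (3 * n + 2) + 6 by ring] using
      eight_dvd_restrictedOverpartitionCount_nine (3 * n + 2)
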